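/- Let $\mathcal X$ be a finite non-empty set, and let $\mathcal T$ be a non-empty, closed, convex set of row-stochastic matrices $T=(T(x,y))_{x,y\in\mathcal X}$ with separately specified rows (for every choice of $T_x\in\mathcal T$, $x\in\mathcal X$, there is $T\in\mathcal T$ with $T(x,\cdot)=T_x(x,\cdot)$ for all $x$). With the convention $0\cdot(\pm\infty)=0$, put, for $f:\mathcal X\to\mathbb R\cup\{+\infty\}$, $$[\underline T f](x)=\inf_{T\in\mathcal T}\sum_{y}T(x,y)f(y),\qquad [\overline T f](x)=\sup_{T\in\mathcal T}\sum_{y}T(x,y)f(y).$$ A situation is a finite string $s=x_0\cdots x_n$ of states ($n\ge 0$) or the empty string $\Box$. The local models are $\overline Q_{x_0\cdots x_n}(f)=[\overline T f](x_n)$, together with an arbitrary initial model $\overline Q_\Box:(\mathbb R\cup\{+\infty\})^{\mathcal X}\to\mathbb R\cup\{+\infty\}$ that maps every real constant to itself, is subadditive and monotone, and satisfies $\overline Q_\Box(\lambda f)=\lambda\overline Q_\Box(f)$ for all $\lambda\in(0,+\infty]$ and all $f\ge 0$. A supermartingale is an extended real-valued map $\mathcal M$ on all situations that is bounded below by a real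 constant and satisfies $\overline Q_s(\mathcal M(s\,\cdot))\le\mathcal M(s)$ for every situation $s$, where $\mathcal M(s\,\cdot)$ is the function $x\mapsto\mathcal M(sx)$. For $f:\mathcal X^{\mathbb N_0}\to[-\infty,+\infty]$ and $x\in\mathcal X$, the game-theoretic upper and lower expectations given $X_0=x$ are $$\overline{\mathbb E}^{\mathrm V}_{\mathcal T}[f\mid X_0=x]=\inf\Bigl\{\mathcal M(x):\mathcal M\text{ a supermartingale with }\liminf_{m\to\infty}\mathcal M(\omega_0\cdots\omega_m)\ge f(\omega)\text{ for all paths }\omega\text{ with }\omega_0=x\Bigr\}$$ and $\underline{\mathbb E}^{\mathrm V}_{\mathcal T}[f\mid X_0=x]=-\overline{\mathbb E}^{\mathrm V}_{\mathcal T}[-f\mid X_0=x]$. Let $A\subseteq\mathcal X$ and let $H_A(\omega)=\inf\{t\in\mathbb N_0:\omega_t\in A\}\in\mathbb N_0\cup\{+\infty\}$. Define $\underline h_A^{(0)}=\overline h_A^{(0)}=\mathbb I_{A^c}$ and, for $n\ge 0$, $$\underline h_A^{(n+1)}=\mathbb I_{A^c}+\mathbb I_{A^c}\cdot\underline T\,\underline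 h_A^{(n)},\qquad \overline h_A^{(n+1)}=\mathbb I_{A^c}+\mathbb I_{A^c}\cdot\overline T\,\overline h_A^{(n)}.$$ Then the pointwise limits of these sequences exist in $[0,+\infty]^{\mathcal X}$, and $$\underline{\mathbb E}^{\mathrm V}_{\mathcal T}[H_A\mid X_0]=\lim_{n\to+\infty}\underline h_A^{(n)},\qquad \overline{\mathbb E}^{\mathrm V}_{\mathcal T}[H_A\mid X_0]=\lim_{n\to+\infty}\overline h_A^{(n)}.$$ -/

import Mathlib

open Filter Topology

/-! Imprecise Markov chains on a finite state space `X`.  Extended real-valued functions are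
`EReal`-valued; Mathlib's multiplication on `EReal` satisfies `0 * ⊤ = 0 = 0 * ⊥`. -/

noncomputable section

namespace ImpreciseMarkov

variable {X : Type*}

/-- A set of matrices has separately specified rows: rows chosen from arbitrary members of the set
can be recombined into a single member of the set. -/
def HasSeparatelySpecifiedRows (𝒯 : Set (Matrix X X ℝ)) : Prop :=
  ∀ R : X → Matrix X X ℝ, (∀ x, R x ∈ 𝒯) → ∃ T ∈ 𝒯, ∀ x y, T x y = R x x y

/-- The action `[T f](x) = ∑ y, T(x, y) f(y)` of a transition matrix on extended functions. -/
def transApply [Fintype X] (T : Matrix X X ℝ) (f : X → EReal) (x : X) : EReal :=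
  ∑ y, (T x y : EReal) * f y

/-- The lower transition operator `[T̲ f](x) = inf_{T ∈ 𝒯} [T f](x)`. -/
def lowerTrans [Fintype X] (𝒯 : Set (Matrix X X ℝ)) (f : X → EReal) (x : X) : EReal :=
  ⨅ T ∈ 𝒯, transApply T f x

/-- The upper transition operator `[T̄ f](x) = sup_{T ∈ 𝒯} [T f](x)`. -/
def upperTrans [Fintype X] (𝒯 : Set (Matrix X X ℝ)) (f : X → EReal) (x : X) : EReal :=
  ⨆ T ∈ 𝒯, transApply T f x

/-! ### Game-theoretic upper and lower expectations

A situation `x_{0:n}` is the nonempty list `[x_0, …, x_n]`; the empty list is the initial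
situation `□`.  Paths are functions `ω : ℕ → X`. -/

/-- The axioms of a local uncertainty model, an operator on the functions with values in
`ℝ ∪ {+∞}` (that is, the `EReal`-valued functions that never take the value `⊥`).  The values of
`Q` at other functions play no role. -/
structure IsLocalModel (Q : (X → EReal) → EReal) : Prop where
  ne_bot : ∀ f : X → EReal, (∀ x, f x ≠ ⊥) → Q f ≠ ⊥
  const : ∀ c : ℝ, Q (fun _ => (c : EReal)) = c
  add_le : ∀ f g : X → EReal, (∀ x, f x ≠ ⊥) → (∀ x, g x ≠ ⊥) →
    Q (fun x => f x + g x) ≤ Q f + Q g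
  pos_homog : ∀ (a : EReal) (f : X → EReal), 0 < a → (∀ x, 0 ≤ f x) →
    Q (fun x => a * f x) = a * Q f
  mono : ∀ f g : X → EReal, (∀ x, f x ≠ ⊥) → (∀ x, g x ≠ ⊥) → (∀ x, f x ≤ g x) → Q f ≤ Q g

/-- A supermartingale for the family `Q` of local models: an extended real-valued map on all
situations, including `□`, that is uniformly bounded below and satisfies `Q_s(M(s ·)) ≤ M(s)`. -/
structure IsSupermartingale (Q : List X → (X → EReal) → EReal) (M : List X → EReal) : Prop where
  bddBelow : ∃ c : ℝ, ∀ s, (c : EReal) ≤ M s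
  le : ∀ s, Q s (fun x => M (s ++ [x])) ≤ M s

/-- The situation formed by the first `n` states `ω 0, …, ω (n - 1)` of the path `ω`. -/
def pathPrefix (ω : ℕ → X) (n : ℕ) : List X := (List.range n).map ω

/-- The game-theoretic upper expectation of `f` conditional on the situation `s`: the infimum of
`M(s)` over the supermartingales `M` with `liminf M ≥ f` on all paths through `s`. -/
def upperExp (Q : List X → (X → EReal) → EReal) (f : (ℕ → X) → EReal) (s : List X) : EReal :=
  sInf {a | ∃ M : List X → EReal, IsSupermartingale Q M ∧
    (∀ ω : ℕ → X, pathPrefix ω s.length = s →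
      f ω ≤ liminf (fun m => M (pathPrefix ω m)) atTop) ∧ a = M s}

/-- The conjugate game-theoretic lower expectation. -/
def lowerExp (Q : List X → (X → EReal) → EReal) (f : (ℕ → X) → EReal) (s : List X) : EReal :=
  -upperExp Q (fun ω => -f ω) s

/-- The local models of the game-theoretic imprecise Markov chain induced by `𝒯`, with initial
local model `Q₀`: in a situation with last state `x`, the model is `f ↦ [T̄ f](x)`. -/
def markovLocalModel [Fintype X] (𝒯 : Set (Matrix X X ℝ)) (Q₀ : (X → EReal) → EReal)
    (s : List X) : (X → EReal) → EReal :=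
  match s.getLast? with
  | none => Q₀
  | some x => fun f => upperTrans 𝒯 f x

/-! ### Hitting times -/

/-- The hitting time `H_A(ω) = inf {t : ω t ∈ A}`, equal to `⊤` if `A` is never hit. -/
def hittingTime (A : Set X) (ω : ℕ → X) : EReal :=
  ⨅ t ∈ {t : ℕ | ω t ∈ A}, (t : EReal)

/-- The indicator of the complement of `A`. -/
def indCompl (A : Set X) : X → EReal := Set.indicator Aᶜ (fun _ => 1)

/-- The iteration `h⁽⁰⁾ = 𝕀_{Aᶜ}`, `h⁽ⁿ⁺¹⁾ = 𝕀_{Aᶜ} + 𝕀_{Aᶜ} · T̲ h⁽ⁿ⁾`. -/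
def lowerIter [Fintype X] (𝒯 : Set (Matrix X X ℝ)) (A : Set X) : ℕ → X → EReal
  | 0 => indCompl A
  | n + 1 => fun x => indCompl A x + indCompl A x * lowerTrans 𝒯 (lowerIter 𝒯 A n) x

/-- The iteration `h⁽⁰⁾ = 𝕀_{Aᶜ}`, `h⁽ⁿ⁺¹⁾ = 𝕀_{Aᶜ} + 𝕀_{Aᶜ} · T̄ h⁽ⁿ⁾`. -/
def upperIter [Fintype X] (𝒯 : Set (Matrix X X ℝ)) (A : Set X) : ℕ → X → EReal
  | 0 => indCompl A
  | n + 1 => fun x => indCompl A x + indCompl A x * upperTrans 𝒯 (upperIter 𝒯 A n) x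

end ImpreciseMarkov

end

open ImpreciseMarkov

/-!
Write `Φ` for the lower or the upper transition operator. The iterates of the recursion increase
with `n`, and the `n`-th one is the `Φ`-expectation of the hitting time truncated at `n + 1`
(`truncHit`); it is `1 + truncTail` outside `A` and `0` on `A`. The limit is therefore a supremum,
and each of the two expectations has to be bounded by this supremum from both sides. All four
bounds use processes of the form "number of steps before `A` so far, plus an estimate of the
further ones" (`stoppedCost`).

* Upper expectation, from above (`upperExp_hittingTime_le`): with the limit of the recursion as
  the estimate, the process is a supermartingale that dominates the hitting time, because
  transition matrices are continuous along increasing sequences (`transApply_iSup_le`).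
* Lower expectation, from below (`truncHit_le_lowerExp_hittingTime`): minus the process truncated
  at a finite horizon (`truncCost`) is a bounded supermartingale.
* Upper expectation, from below (`truncHit_le_upperExp_hittingTime`): a supermartingale that
  starts strictly below the truncated process can be kept below it along a whole path by a fixed
  margin.
* Lower expectation, from above (`lowerExp_hittingTime_le`): since the set of matrices is compact
  with separately specified rows, the limit of the recursion is a supersolution of the recursion
  for a single matrix `T` (`exists_transApply_iSup_truncHit_le`). For this `T`, adding the process
  to a supermartingale gives a process that decreases on average, hence does not increase along a
  suitable path. If it started below zero, it would be bounded above on this path; as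
  supermartingales are bounded below, the path would hit `A`, where the supermartingale
  contradicts its terminal condition.

No measure on the path space is needed: an average is never smaller than all of the averaged
values (`exists_le_of_transApply_le`), so a path along which a process does not increase can be
built one state at a time (`exists_path_of_extend`).
-/

namespace ImpreciseMarkov

variable {X : Type*}

/-! ### Paths and first hits -/

lemma pathPrefix_succ (ω : ℕ → X) (n : ℕ) :
    pathPrefix ω (n + 1) = pathPrefix ω n ++ [ω n] := by
  simp [pathPrefix, List.range_succ]

lemma length_pathPrefix (ω : ℕ → X) (n : ℕ) : (pathPrefix ω n).length = n := by
  simp [pathPrefix]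

/-- A property of situations that always passes to some one-state extension holds along a whole
path. -/
lemma exists_path_of_extend {D : List X → Prop} {x : X} (h0 : D [x])
    (hstep : ∀ s x, D (s ++ [x]) → ∃ y, D (s ++ [x] ++ [y])) :
    ∃ ω : ℕ → X, ω 0 = x ∧ ∀ m, D (pathPrefix ω (m + 1)) := by
  choose! next hnext using hstep
  let step : List X × X → List X × X := fun p => (p.1 ++ [p.2], next p.1 p.2)
  let ω : ℕ → X := fun n => (step^[n] ([], x)).2
  have hω : ∀ n, (step^[n] ([], x)).1 = pathPrefix ω n := by
    intro n
    induction n with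
    | zero => simp [pathPrefix]
    | succ n ih => rw [pathPrefix_succ, Function.iterate_succ_apply', ← ih]
  refine ⟨ω, rfl, fun m => ?_⟩
  induction m with
  | zero => simpa [pathPrefix, ω] using h0
  | succ m ih =>
    rw [pathPrefix_succ] at ih ⊢
    have := hnext _ _ ih
    rw [← hω m] at this
    rw [pathPrefix_succ, ← hω m]
    simpa [ω, Function.iterate_succ_apply', step] using this

open Classical in
/-- The number of steps made before `A` along the string `s`: the position of the first state
in `A`, and the length of `s` if there is none. -/
noncomputable def firstHit (A : Set X) (s : List X) : ℕ := s.findIdx (fun x => decide (x ∈ A))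

variable {A : Set X}

lemma firstHit_nil : firstHit A [] = 0 := rfl

lemma firstHit_le_length (s : List X) : firstHit A s ≤ s.length := List.findIdx_le_length

lemma firstHit_append_of_lt {s : List X} (h : firstHit A s < s.length) (l : List X) :
    firstHit A (s ++ l) = firstHit A s := by
  unfold firstHit at *
  rw [List.findIdx_append, if_pos h]

lemma firstHit_append_of_mem {s : List X} (h : firstHit A s = s.length) {x : X} (hx : x ∈ A) :
    firstHit A (s ++ [x]) = s.length := by
  unfold firstHit at *
  rw [List.findIdx_append, if_neg h.not_lt]
  simp [hx]

lemma firstHit_append_of_notMem {s : List X} (h : firstHit A s = s.length) {x : X}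
    (hx : x ∉ A) : firstHit A (s ++ [x]) = (s ++ [x]).length := by
  unfold firstHit at *
  rw [List.findIdx_append, if_neg h.not_lt]
  simp [hx, add_comm]

/-- Along a path, the first hit of the prefixes determines the hitting time: either it is
eventually the finite hitting time, or no prefix meets `A`. -/
lemma hittingTime_cases (A : Set X) (ω : ℕ → X) :
    (∃ k : ℕ, hittingTime A ω = k ∧ ∀ m, k < m → firstHit A (pathPrefix ω m) = k) ∨
      (hittingTime A ω = ⊤ ∧ ∀ m, firstHit A (pathPrefix ω m) = m) := by
  classical
  by_cases h : ∃ k, ω k ∈ A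
  · left
    refine ⟨Nat.find h, ?_, fun m hm => ?_⟩
    · apply le_antisymm
      · exact iInf₂_le_of_le (Nat.find h) (Nat.find_spec h) le_rfl
      · refine le_iInf₂ fun t ht => ?_
        exact_mod_cast Nat.find_min' h ht
    · have hlt : Nat.find h < (pathPrefix ω m).length := by rwa [length_pathPrefix]
      unfold firstHit
      rw [List.findIdx_eq hlt]
      refine ⟨by simpa [pathPrefix] using Nat.find_spec h, fun j hj => ?_⟩
      simpa [pathPrefix] using Nat.find_min h hj
  · right
    push Not at h
    refine ⟨by simp [hittingTime, h], fun m => ?_⟩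
    induction m with
    | zero => rfl
    | succ m ih =>
      rw [pathPrefix_succ, firstHit_append_of_notMem (by rw [ih, length_pathPrefix]) (h m)]
      simp [length_pathPrefix]

/-! ### Transition operators -/

section Trans

variable [Fintype X]

lemma transApply_add {T : Matrix X X ℝ} (h0 : ∀ x y, 0 ≤ T x y) (f g : X → EReal) (x : X) :
    transApply T (fun y => f y + g y) x = transApply T f x + transApply T g x := by
  simp only [transApply, ← Finset.sum_add_distrib]
  exact Finset.sum_congr rfl fun y _ => EReal.left_distrib_of_nonneg_of_ne_top
    (EReal.coe_nonneg.2 (h0 x y)) (EReal.coe_ne_top _) _ _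

lemma transApply_coe (T : Matrix X X ℝ) (f : X → ℝ) (x : X) :
    transApply T (fun y => (f y : EReal)) x = ((∑ y, T x y * f y : ℝ) : EReal) := by
  simp only [transApply, ← EReal.coe_mul]
  exact (map_sum (⟨⟨Real.toEReal, EReal.coe_zero⟩, EReal.coe_add⟩ : ℝ →+ EReal) _ _).symm

lemma transApply_mono {T : Matrix X X ℝ} (h0 : ∀ x y, 0 ≤ T x y) {f g : X → EReal}
    (hfg : ∀ y, f y ≤ g y) (x : X) : transApply T f x ≤ transApply T g x :=
  Finset.sum_le_sum fun y _ => mul_le_mul_of_nonneg_left (hfg y) (EReal.coe_nonneg.2 (h0 x y))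

lemma transApply_neg (T : Matrix X X ℝ) {f : X → EReal} (hb : ∀ y, f y ≠ ⊥) (ht : ∀ y, f y ≠ ⊤)
    (x : X) : transApply T (fun y => -f y) x = -transApply T f x := by
  lift f to X → ℝ using fun y => ⟨ht y, hb y⟩
  simp only [← EReal.coe_neg, transApply_coe]
  simp

variable [DecidableEq X] {T : Matrix X X ℝ}

lemma transApply_const (hT : T ∈ Matrix.rowStochastic ℝ X) (c : ℝ) (x : X) :
    transApply T (fun _ => (c : EReal)) x = c := by
  rw [transApply_coe, ← Finset.sum_mul, Matrix.sum_row_of_mem_rowStochastic hT, one_mul]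

lemma transApply_const_add (hT : T ∈ Matrix.rowStochastic ℝ X) (c : ℝ) (f : X → EReal) (x : X) :
    transApply T (fun y => c + f y) x = c + transApply T f x := by
  rw [transApply_add (fun _ _ => Matrix.nonneg_of_mem_rowStochastic hT), transApply_const hT]

/-- An average is at least the smallest of the averaged values. -/
lemma exists_le_of_transApply_le [Nonempty X] (hT : T ∈ Matrix.rowStochastic ℝ X) {f : X → EReal}
    {x : X} {a : EReal} (h : transApply T f x ≤ a) : ∃ y, f y ≤ a := by
  by_contra! hlt
  obtain ⟨y₀, hy₀⟩ := Finite.exists_min f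
  obtain ⟨c, hac, hc⟩ := EReal.lt_iff_exists_real_btwn.1 (hlt y₀)
  have := transApply_mono (T := T) (fun _ _ => Matrix.nonneg_of_mem_rowStochastic hT)
    (fun y => hc.le.trans (hy₀ y)) x
  rw [transApply_const hT] at this
  exact absurd (this.trans h) hac.not_ge

/-- Continuity of a transition matrix along increasing sequences of nonnegative functions. -/
lemma transApply_iSup_le (h0 : ∀ x y, 0 ≤ T x y) {h : ℕ → X → EReal} (hmono : Monotone h)
    (hnonneg : ∀ n y, 0 ≤ h n y) {x : X} {L : EReal} (hL : ∀ n, transApply T (h n) x ≤ L) :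
    transApply T (fun y => ⨆ n, h n y) x ≤ L := by
  have hterm : ∀ y, Tendsto (fun n => (T x y : EReal) * h n y) atTop
      (𝓝 ((T x y : EReal) * ⨆ n, h n y)) := by
    intro y
    have ht : Tendsto (fun n => h n y) atTop (𝓝 (⨆ n, h n y)) :=
      tendsto_atTop_iSup fun a b hab => hmono hab y
    exact EReal.Tendsto.const_mul ht (.inl (EReal.coe_ne_bot _)) (.inl (EReal.coe_ne_top _))
  have hsup : ∀ y, 0 ≤ ⨆ n, h n y := fun y => le_iSup_of_le 0 (hnonneg 0 y)
  have hsum : ∀ S : Finset X, Tendsto (fun n => ∑ y ∈ S, (T x y : EReal) * h n y) atTop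
      (𝓝 (∑ y ∈ S, (T x y : EReal) * ⨆ n, h n y)) := by
    intro S
    induction S using Finset.induction_on with
    | empty => simp
    | insert y S hy ih =>
      simp only [Finset.sum_insert hy]
      have hb1 : (T x y : EReal) * ⨆ n, h n y ≠ ⊥ :=
        ne_bot_of_le_ne_bot EReal.zero_ne_bot
          (mul_nonneg (EReal.coe_nonneg.2 (h0 x y)) (hsup y))
      have hb2 : ∑ y ∈ S, (T x y : EReal) * ⨆ n, h n y ≠ ⊥ :=
        ne_bot_of_le_ne_bot EReal.zero_ne_bot (Finset.sum_nonneg fun z _ =>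
          mul_nonneg (EReal.coe_nonneg.2 (h0 x z)) (hsup z))
      exact (EReal.continuousAt_add (.inr hb2) (.inl hb1)).tendsto.comp
        ((hterm y).prodMk_nhds ih)
  exact le_of_tendsto' (hsum Finset.univ) hL

end Trans

/-! ### Truncated hitting times -/

/-- The properties of the lower and the upper transition operator on which the
finite-horizon recursion rests. -/
structure IsTransOperator (Φ : (X → EReal) → X → EReal) : Prop where
  mono : ∀ {f g : X → EReal}, (∀ y, f y ≤ g y) → ∀ x, Φ f x ≤ Φ g x
  const : ∀ (c : ℕ) x, Φ (fun _ => (c : EReal)) x = c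
  add_le : ∀ (c : ℕ) f x, c + Φ f x ≤ Φ (fun y => c + f y) x

/-- The number of steps, counted up to `k` and excluding the present one, made before `A`, in
expectation with respect to the one-step operator `Φ`, from a present state outside `A`. -/
noncomputable def truncTail (Φ : (X → EReal) → X → EReal) (A : Set X) : ℕ → X → EReal
  | 0 => fun _ => 0
  | k + 1 => Φ (fun y => indCompl A y + indCompl A y * truncTail Φ A k y)

/-- The expectation with respect to `Φ` of the hitting time of `A` truncated at `k + 1`. -/
noncomputable def truncHit (Φ : (X → EReal) → X → EReal) (A : Set X) (k : ℕ) (x : X) : EReal :=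
  indCompl A x + indCompl A x * truncTail Φ A k x

section Iter

variable {Φ : (X → EReal) → X → EReal} {A : Set X}

lemma truncTail_succ (k : ℕ) : truncTail Φ A (k + 1) = Φ (truncHit Φ A k) := rfl

lemma truncHit_of_mem {x : X} (hx : x ∈ A) (k : ℕ) : truncHit Φ A k x = 0 := by
  simp [truncHit, indCompl, hx]

lemma truncHit_of_notMem {x : X} (hx : x ∉ A) (k : ℕ) :
    truncHit Φ A k x = 1 + truncTail Φ A k x := by
  simp [truncHit, indCompl, hx]

lemma truncHit_mono_of_truncTail {j k : ℕ} {x : X} (h : truncTail Φ A j x ≤ truncTail Φ A k x) :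
    truncHit Φ A j x ≤ truncHit Φ A k x := by
  by_cases hx : x ∈ A
  · simp [truncHit_of_mem hx]
  · rw [truncHit_of_notMem hx, truncHit_of_notMem hx]
    gcongr

lemma truncTail_nonneg (hΦ : IsTransOperator Φ) (k : ℕ) (x : X) : 0 ≤ truncTail Φ A k x := by
  induction k generalizing x with
  | zero => exact le_rfl
  | succ k ih =>
    have h0 : ∀ y, ((0 : ℕ) : EReal) ≤ truncHit Φ A k y := by
      intro y
      by_cases hy : y ∈ A
      · simp [truncHit_of_mem hy]
      · rw [truncHit_of_notMem hy]
        simpa using add_nonneg zero_le_one (ih y)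
    have := hΦ.mono h0 x
    rwa [hΦ.const, Nat.cast_zero] at this

lemma truncHit_nonneg (hΦ : IsTransOperator Φ) (k : ℕ) (x : X) : 0 ≤ truncHit Φ A k x := by
  by_cases hx : x ∈ A
  · rw [truncHit_of_mem hx]
  · rw [truncHit_of_notMem hx]
    exact add_nonneg zero_le_one (truncTail_nonneg hΦ k x)

lemma truncTail_le (hΦ : IsTransOperator Φ) (k : ℕ) (x : X) : truncTail Φ A k x ≤ k := by
  induction k generalizing x with
  | zero => simp [truncTail]
  | succ k ih =>
    have h0 : ∀ y, truncHit Φ A k y ≤ ((k + 1 : ℕ) : EReal) := by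
      intro y
      by_cases hy : y ∈ A
      · rw [truncHit_of_mem hy]
        positivity
      · rw [truncHit_of_notMem hy, add_comm]
        push_cast
        gcongr
        exact ih y
    simpa only [hΦ.const, truncTail_succ] using hΦ.mono h0 x

lemma truncHit_le (hΦ : IsTransOperator Φ) (k : ℕ) (x : X) :
    truncHit Φ A k x ≤ ((k + 1 : ℕ) : EReal) := by
  by_cases hx : x ∈ A
  · rw [truncHit_of_mem hx]
    positivity
  · rw [truncHit_of_notMem hx, add_comm]
    push_cast
    gcongr
    exact truncTail_le hΦ k x

lemma truncTail_monotone (hΦ : IsTransOperator Φ) : Monotone (truncTail Φ A) := by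
  refine monotone_nat_of_le_succ fun k => ?_
  induction k with
  | zero => exact fun x => truncTail_nonneg hΦ 1 x
  | succ k ih =>
    rw [truncTail_succ, truncTail_succ]
    exact hΦ.mono fun y => truncHit_mono_of_truncTail (ih y)

lemma truncHit_monotone (hΦ : IsTransOperator Φ) : Monotone (truncHit Φ A) :=
  fun _ _ hjk x => truncHit_mono_of_truncTail (truncTail_monotone hΦ hjk x)

lemma one_add_iSup_truncTail_le {x : X} (hx : x ∉ A) :
    1 + ⨆ k, truncTail Φ A k x ≤ ⨆ k, truncHit Φ A k x := by
  rw [add_comm, ← EReal.le_sub_iff_add_le (.inl (by decide)) (.inl (by decide))]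
  refine iSup_le fun k => ?_
  rw [EReal.le_sub_iff_add_le (.inl (by decide)) (.inl (by decide)), add_comm,
    ← truncHit_of_notMem hx]
  exact le_iSup (fun k => truncHit Φ A k x) k

end Iter

/-! ### Stopped cost processes -/

/-- The number of steps before `A` along `s`, truncated at `N`, plus an estimate `r` of the number
of further steps, which depends on the length and the last state of `s` and is dropped once `A`
has been hit. -/
noncomputable def stoppedCost (A : Set X) (N : EReal) (r : ℕ → X → EReal) (s : List X) : EReal :=
  min (firstHit A s : EReal) N +
    if firstHit A s < s.length then 0 else s.getLast?.elim 0 (r s.length)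

section Cost

variable {A : Set X} {N : EReal} {r : ℕ → X → EReal}

lemma stoppedCost_of_lt {s : List X} (h : firstHit A s < s.length) :
    stoppedCost A N r s = min (firstHit A s : EReal) N := by
  simp [stoppedCost, h]

lemma stoppedCost_of_eq {s : List X} {x : X} (h : firstHit A (s ++ [x]) = (s ++ [x]).length) :
    stoppedCost A N r (s ++ [x]) =
      min ((s ++ [x]).length : EReal) N + r (s ++ [x]).length x := by
  simp only [stoppedCost, h, lt_irrefl, if_false]
  simp

lemma stoppedCost_append_of_lt {s : List X} (h : firstHit A s < s.length) (y : X) :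
    stoppedCost A N r (s ++ [y]) = stoppedCost A N r s := by
  rw [stoppedCost_of_lt h, stoppedCost_of_lt, firstHit_append_of_lt h]
  rw [firstHit_append_of_lt h]
  simp; omega

lemma stoppedCost_append_of_mem {s : List X} (h : firstHit A s = s.length) {y : X} (hy : y ∈ A) :
    stoppedCost A N r (s ++ [y]) = min (s.length : EReal) N := by
  rw [stoppedCost_of_lt, firstHit_append_of_mem h hy]
  rw [firstHit_append_of_mem h hy]
  simp

lemma stoppedCost_append_of_notMem {s : List X} (h : firstHit A s = s.length) {y : X}
    (hy : y ∉ A) :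
    stoppedCost A N r (s ++ [y]) = min ((s.length + 1 : ℕ) : EReal) N + r (s.length + 1) y := by
  rw [stoppedCost_of_eq (firstHit_append_of_notMem h hy)]
  simp

lemma stoppedCost_singleton_of_mem {x : X} (hx : x ∈ A) (hN : 0 ≤ N) :
    stoppedCost A N r [x] = 0 := by
  simpa [hN] using stoppedCost_append_of_mem (N := N) (r := r) (firstHit_nil (A := A)) hx

lemma stoppedCost_singleton_of_notMem {x : X} (hx : x ∉ A) (hN : 1 ≤ N) :
    stoppedCost A N r [x] = 1 + r 1 x := by
  simpa [hN] using stoppedCost_append_of_notMem (N := N) (r := r) (firstHit_nil (A := A)) hx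

lemma stoppedCost_nonneg (hN : 0 ≤ N) (hr : ∀ m x, 0 ≤ r m x) (s : List X) :
    0 ≤ stoppedCost A N r s := by
  unfold stoppedCost
  refine add_nonneg (le_min (by positivity) hN) ?_
  split_ifs
  · exact le_rfl
  · cases s.getLast? with
    | none => exact le_rfl
    | some x => exact hr _ _

lemma stoppedCost_le_add {R : EReal} (hR : 0 ≤ R) (hr : ∀ m x, r m x ≤ R) (s : List X) :
    stoppedCost A N r s ≤ N + R := by
  unfold stoppedCost
  refine add_le_add (min_le_right _ _) ?_
  split_ifs
  · exact hR
  · cases s.getLast? with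
    | none => exact hR
    | some x => exact hr _ _

/-- Along a path the untruncated cost process is eventually equal to a finite hitting time, and
grows beyond all bounds if the hitting time is infinite. -/
lemma stoppedCost_top_pathPrefix_cases (hr : ∀ m x, 0 ≤ r m x) (ω : ℕ → X) :
    (∃ k : ℕ, hittingTime A ω = k ∧ ∀ᶠ m in atTop, stoppedCost A ⊤ r (pathPrefix ω m) = k) ∨
      (hittingTime A ω = ⊤ ∧ ∀ m : ℕ, (m : EReal) ≤ stoppedCost A ⊤ r (pathPrefix ω m)) := by
  rcases hittingTime_cases A ω with ⟨k, hk, h⟩ | ⟨hk, h⟩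
  · refine .inl ⟨k, hk, ?_⟩
    filter_upwards [eventually_gt_atTop k] with m hm
    rw [stoppedCost_of_lt (by rwa [h m hm, length_pathPrefix]), h m hm]
    simp
  · refine .inr ⟨hk, fun m => ?_⟩
    cases m with
    | zero => simpa using stoppedCost_nonneg le_top hr _
    | succ m =>
      rw [pathPrefix_succ, stoppedCost_of_eq, ← pathPrefix_succ, length_pathPrefix]
      · simpa using add_le_add_right (hr (m + 1) (ω m)) ((m + 1 : ℕ) : EReal)
      · rw [← pathPrefix_succ, h, length_pathPrefix]

variable [Fintype X] [DecidableEq X] {T : Matrix X X ℝ}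

/-- If `h` dominates one step plus the estimate `r` of the further steps, and `r` dominates the
average of `h`, then the untruncated cost process decreases on average. -/
lemma transApply_stoppedCost_top_le (hT : T ∈ Matrix.rowStochastic ℝ X) {h r : X → EReal}
    (h_nonneg : ∀ y, 0 ≤ h y) (hr : ∀ y ∉ A, 1 + r y ≤ h y) (s : List X) {x : X}
    (hx : transApply T h x ≤ r x) :
    transApply T (fun y => stoppedCost A ⊤ (fun _ => r) (s ++ [x] ++ [y])) x ≤
      stoppedCost A ⊤ (fun _ => r) (s ++ [x]) := by
  have hT0 : ∀ x y, 0 ≤ T x y := fun _ _ => Matrix.nonneg_of_mem_rowStochastic hT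
  rcases (firstHit_le_length (A := A) (s ++ [x])).lt_or_eq with hlt | heq
  · simp only [stoppedCost_append_of_lt hlt]
    rw [stoppedCost_of_lt hlt, min_eq_left le_top]
    exact (transApply_const hT (firstHit A (s ++ [x])) x).le
  · rw [stoppedCost_of_eq heq, min_eq_left le_top]
    set L := (s ++ [x]).length
    calc _ ≤ transApply T (fun y => ((L : ℝ) : EReal) + h y) x := by
          refine transApply_mono hT0 (fun y => ?_) x
          by_cases hy : y ∈ A
          · rw [stoppedCost_append_of_mem heq hy, min_eq_left le_top]
            exact le_add_of_nonneg_right (h_nonneg y)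
          · rw [stoppedCost_append_of_notMem heq hy, min_eq_left le_top]
            push_cast
            rw [add_assoc]
            exact add_le_add_right (hr y hy) _
      _ = L + transApply T h x := transApply_const_add hT _ _ _
      _ ≤ L + r x := by gcongr

end Cost

lemma min_natCast (a b : ℕ) : min (a : EReal) b = ((min a b : ℕ) : EReal) := by
  rcases le_total a b with h | h
  · rw [min_eq_left h, min_eq_left (by exact_mod_cast h)]
  · rw [min_eq_right h, min_eq_right (by exact_mod_cast h)]

section Trunc

variable {Φ : (X → EReal) → X → EReal} {A : Set X}

/-- The cost process truncated at the horizon `n + 1`, with the recursively computed expectation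
of the further steps as its estimate. -/
noncomputable def truncCost (Φ : (X → EReal) → X → EReal) (A : Set X) (n : ℕ) :
    List X → EReal :=
  stoppedCost A ((n + 1 : ℕ) : EReal) (fun m => truncTail Φ A (n + 1 - m))

lemma truncCost_singleton (n : ℕ) (x : X) : truncCost Φ A n [x] = truncHit Φ A n x := by
  unfold truncCost
  by_cases hx : x ∈ A
  · rw [stoppedCost_singleton_of_mem hx (by positivity), truncHit_of_mem hx]
  · rw [stoppedCost_singleton_of_notMem hx, truncHit_of_notMem hx, Nat.add_sub_cancel]
    exact_mod_cast Nat.le_add_left 1 n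

lemma truncCost_nonneg (hΦ : IsTransOperator Φ) (n : ℕ) (s : List X) : 0 ≤ truncCost Φ A n s :=
  stoppedCost_nonneg (by positivity) (fun _ => truncTail_nonneg hΦ _) s

lemma truncCost_le (hΦ : IsTransOperator Φ) (n : ℕ) (s : List X) :
    truncCost Φ A n s ≤ (((n + 1) + (n + 1) : ℝ) : EReal) := by
  have := stoppedCost_le_add (A := A) (N := ((n + 1 : ℕ) : EReal)) (R := ((n + 1 : ℕ) : EReal))
    (r := fun m => truncTail Φ A (n + 1 - m)) (by positivity)
    (fun m x => (truncTail_le hΦ _ x).trans (by exact_mod_cast Nat.sub_le _ _)) s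
  exact_mod_cast this

/-- The truncated cost process is no larger than its own one-step expectation. -/
lemma truncCost_le_apply (hΦ : IsTransOperator Φ) (n : ℕ) (s : List X) (x : X) :
    truncCost Φ A n (s ++ [x]) ≤ Φ (fun y => truncCost Φ A n (s ++ [x] ++ [y])) x := by
  unfold truncCost
  rcases (firstHit_le_length (A := A) (s ++ [x])).lt_or_eq with hlt | heq
  · simp only [stoppedCost_append_of_lt hlt]
    rw [stoppedCost_of_lt hlt, min_natCast, hΦ.const]
  · rw [stoppedCost_of_eq heq, min_natCast]
    set L := (s ++ [x]).length
    rcases le_or_gt L n with hL | hL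
    · rw [show n + 1 - L = (n - L) + 1 by omega, truncTail_succ, min_eq_left (by omega)]
      refine (hΦ.add_le _ _ _).trans (hΦ.mono (fun y => ?_) x)
      by_cases hy : y ∈ A
      · rw [stoppedCost_append_of_mem heq hy, truncHit_of_mem hy, min_natCast, min_eq_left (by omega),
          add_zero]
      · rw [stoppedCost_append_of_notMem heq hy, truncHit_of_notMem hy, min_natCast,
          min_eq_left (by omega), Nat.add_sub_add_right, ← add_assoc]
        push_cast
        exact le_rfl
    · rw [Nat.sub_eq_zero_of_le (by omega), min_eq_right (by omega), truncTail, add_zero]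
      refine (hΦ.const (n + 1) x).ge.trans (hΦ.mono (fun y => ?_) x)
      by_cases hy : y ∈ A
      · rw [stoppedCost_append_of_mem heq hy, min_natCast, min_eq_right (by omega)]
      · rw [stoppedCost_append_of_notMem heq hy, min_natCast, min_eq_right (by omega),
          Nat.sub_eq_zero_of_le (by omega), truncTail, add_zero]

/-- Along a path the truncated cost process is eventually constant, with a value that does not
exceed the hitting time. -/
lemma eventually_truncCost_pathPrefix_eq (n : ℕ) (ω : ℕ → X) :
    ∃ q : ℕ, (q : EReal) ≤ hittingTime A ω ∧
      ∀ᶠ m in atTop, truncCost Φ A n (pathPrefix ω m) = q := by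
  unfold truncCost
  rcases hittingTime_cases A ω with ⟨k, hk, h⟩ | ⟨hk, h⟩
  · refine ⟨min k (n + 1), ?_, ?_⟩
    · rw [hk]
      exact_mod_cast min_le_left _ _
    · filter_upwards [eventually_gt_atTop k] with m hm
      rw [stoppedCost_of_lt (by rwa [h m hm, length_pathPrefix]), h m hm, min_natCast]
  · refine ⟨n + 1, hk ▸ le_top, ?_⟩
    filter_upwards [eventually_ge_atTop (n + 1)] with m hm
    obtain ⟨m, rfl⟩ : ∃ j, m = j + 1 := ⟨m - 1, by omega⟩
    rw [pathPrefix_succ, stoppedCost_of_eq, ← pathPrefix_succ, length_pathPrefix, min_natCast,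
      min_eq_right hm, Nat.sub_eq_zero_of_le hm]
    · simp [truncTail]
    · rw [← pathPrefix_succ, h, length_pathPrefix]

end Trunc

/-! ### The lower and the upper transition operator -/

section Operators

variable [Fintype X] {𝒯 : Set (Matrix X X ℝ)} {A : Set X}

lemma lowerTrans_le {T : Matrix X X ℝ} (hT : T ∈ 𝒯) (f : X → EReal) (x : X) :
    lowerTrans 𝒯 f x ≤ transApply T f x := iInf₂_le T hT

lemma le_upperTrans {T : Matrix X X ℝ} (hT : T ∈ 𝒯) (f : X → EReal) (x : X) :
    transApply T f x ≤ upperTrans 𝒯 f x := le_iSup₂ (f := fun T _ => transApply T f x) T hT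

lemma lowerIter_eq_truncHit (n : ℕ) : lowerIter 𝒯 A n = truncHit (lowerTrans 𝒯) A n := by
  induction n with
  | zero => funext x; simp [lowerIter, truncHit, truncTail]
  | succ n ih => funext x; rw [lowerIter, ih, truncHit, truncTail_succ]

lemma upperIter_eq_truncHit (n : ℕ) : upperIter 𝒯 A n = truncHit (upperTrans 𝒯) A n := by
  induction n with
  | zero => funext x; simp [upperIter, truncHit, truncTail]
  | succ n ih => funext x; rw [upperIter, ih, truncHit, truncTail_succ]

variable [DecidableEq X]

lemma isTransOperator_lowerTrans (h_stoch : ∀ T ∈ 𝒯, T ∈ Matrix.rowStochastic ℝ X)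
    (h_nonempty : 𝒯.Nonempty) : IsTransOperator (lowerTrans 𝒯) where
  mono h x := iInf₂_mono fun T hT =>
    transApply_mono (fun _ _ => Matrix.nonneg_of_mem_rowStochastic (h_stoch T hT)) h x
  const c x := by
    have : Nonempty 𝒯 := h_nonempty.to_subtype
    rw [lowerTrans, iInf_subtype',
      show (c : EReal) = ((c : ℝ) : EReal) from rfl,
      iInf_congr fun T : 𝒯 => transApply_const (h_stoch T T.2) (c : ℝ) x, iInf_const]
  add_le c f x := le_iInf₂ fun T hT =>
    (add_le_add_right (lowerTrans_le hT f x) _).trans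
      (transApply_const_add (h_stoch T hT) (c : ℝ) f x).ge

lemma isTransOperator_upperTrans (h_stoch : ∀ T ∈ 𝒯, T ∈ Matrix.rowStochastic ℝ X)
    (h_nonempty : 𝒯.Nonempty) : IsTransOperator (upperTrans 𝒯) where
  mono h x := iSup₂_mono fun T hT =>
    transApply_mono (fun _ _ => Matrix.nonneg_of_mem_rowStochastic (h_stoch T hT)) h x
  const c x := by
    have : Nonempty 𝒯 := h_nonempty.to_subtype
    rw [upperTrans, iSup_subtype',
      show (c : EReal) = ((c : ℝ) : EReal) from rfl,
      iSup_congr fun T : 𝒯 => transApply_const (h_stoch T T.2) (c : ℝ) x, iSup_const]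
  add_le c f x := by
    have hb : ((c : ℝ) : EReal) ≠ ⊥ := EReal.coe_ne_bot _
    have ht : ((c : ℝ) : EReal) ≠ ⊤ := EReal.coe_ne_top _
    change ((c : ℝ) : EReal) + _ ≤ _
    rw [add_comm, ← EReal.le_sub_iff_add_le (.inl hb) (.inl ht)]
    refine iSup₂_le fun T hT => ?_
    rw [EReal.le_sub_iff_add_le (.inl hb) (.inl ht), add_comm,
      ← transApply_const_add (h_stoch T hT)]
    exact le_upperTrans hT _ x

lemma upperTrans_const_add_le (h_stoch : ∀ T ∈ 𝒯, T ∈ Matrix.rowStochastic ℝ X) (c : ℝ)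
    (f : X → EReal) (x : X) : upperTrans 𝒯 (fun y => c + f y) x ≤ c + upperTrans 𝒯 f x :=
  iSup₂_le fun T hT => by
    rw [transApply_const_add (h_stoch T hT)]
    exact add_le_add_right (le_upperTrans hT f x) _

lemma isCompact_of_isClosed_of_rowStochastic
    (h_stoch : ∀ T ∈ 𝒯, T ∈ Matrix.rowStochastic ℝ X) (h_closed : IsClosed 𝒯) :
    IsCompact 𝒯 := by
  have h : IsCompact (Set.univ.pi fun _ : X => Set.univ.pi fun _ : X => Set.Icc (0 : ℝ) 1) :=
    isCompact_univ_pi fun _ => isCompact_univ_pi fun _ => isCompact_Icc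
  exact h.of_isClosed_subset h_closed fun T hT x _ y _ =>
    ⟨Matrix.nonneg_of_mem_rowStochastic (h_stoch T hT),
      Matrix.le_one_of_mem_rowStochastic (h_stoch T hT)⟩

/-- A single matrix `T` of the set turns the limit of the lower recursion into a supersolution:
compactness gives a suitable matrix for each state, and its rows can be recombined. -/
lemma exists_transApply_iSup_truncHit_le (h_stoch : ∀ T ∈ 𝒯, T ∈ Matrix.rowStochastic ℝ X)
    (h_nonempty : 𝒯.Nonempty) (h_closed : IsClosed 𝒯) (h_rows : HasSeparatelySpecifiedRows 𝒯) :
    ∃ T ∈ 𝒯, ∀ x, transApply T (fun y => ⨆ k, truncHit (lowerTrans 𝒯) A k y) x ≤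
      ⨆ k, truncTail (lowerTrans 𝒯) A k x := by
  have hΦ := isTransOperator_lowerTrans h_stoch h_nonempty
  have hcomp := isCompact_of_isClosed_of_rowStochastic h_stoch h_closed
  have hT0 : ∀ T ∈ 𝒯, ∀ x y, 0 ≤ T x y := fun T hT _ _ =>
    Matrix.nonneg_of_mem_rowStochastic (h_stoch T hT)
  suffices hrow : ∀ x, ∃ T ∈ 𝒯, transApply T (fun y => ⨆ k, truncHit (lowerTrans 𝒯) A k y) x ≤
      ⨆ k, truncTail (lowerTrans 𝒯) A k x by
    choose R hR𝒯 hR using hrow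
    obtain ⟨T, hT, hTR⟩ := h_rows R hR𝒯
    exact ⟨T, hT, fun x => by simpa only [transApply, hTR] using hR x⟩
  intro x
  set L := ⨆ k, truncTail (lowerTrans 𝒯) A k x
  have hcont : ∀ n, Continuous fun T : Matrix X X ℝ =>
      transApply T (truncHit (lowerTrans 𝒯) A n) x := by
    intro n
    have hreal : truncHit (lowerTrans 𝒯) A n =
        fun y => ((truncHit (lowerTrans 𝒯) A n y).toReal : EReal) := by
      funext y
      exact (EReal.coe_toReal (ne_top_of_le_ne_top (EReal.natCast_ne_top _) (truncHit_le hΦ n y))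
        (ne_bot_of_le_ne_bot EReal.zero_ne_bot (truncHit_nonneg hΦ n y))).symm
    rw [hreal]
    simp only [transApply_coe]
    exact continuous_coe_real_ereal.comp (by fun_prop)
  -- The matrices that are good enough for the level `n` form a decreasing sequence of nonempty
  -- compact sets; a common member is good enough for the limit.
  let C : ℕ → Set (Matrix X X ℝ) := fun n =>
    𝒯 ∩ {T | transApply T (truncHit (lowerTrans 𝒯) A n) x ≤ L}
  have hC_closed : ∀ n, IsClosed (C n) := fun n =>
    h_closed.inter (isClosed_le (hcont n) continuous_const)
  obtain ⟨T, hT⟩ : (⋂ n, C n).Nonempty := by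
    refine IsCompact.nonempty_iInter_of_sequence_nonempty_isCompact_isClosed C ?_ ?_
      (hcomp.of_isClosed_subset (hC_closed 0) Set.inter_subset_left) hC_closed
    · exact fun n T hT => ⟨hT.1, (transApply_mono (hT0 T hT.1)
        (truncHit_monotone hΦ n.le_succ) x).trans hT.2⟩
    · intro n
      obtain ⟨T, hT, hmin⟩ := hcomp.exists_isMinOn h_nonempty (hcont n).continuousOn
      refine ⟨T, hT, ?_⟩
      have h1 : transApply T (truncHit (lowerTrans 𝒯) A n) x ≤
          truncTail (lowerTrans 𝒯) A (n + 1) x := le_iInf₂ fun S hS => hmin hS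
      exact h1.trans (le_iSup (fun k => truncTail (lowerTrans 𝒯) A k x) (n + 1))
  rw [Set.mem_iInter] at hT
  exact ⟨T, (hT 0).1, transApply_iSup_le (hT0 T (hT 0).1) (truncHit_monotone hΦ)
    (truncHit_nonneg hΦ) fun n => (hT n).2⟩

end Operators

/-! ### Supermartingales and expected hitting times -/

section Martingale

variable [Fintype X] {𝒯 : Set (Matrix X X ℝ)} {Q₀ : (X → EReal) → EReal} {A : Set X}

lemma markovLocalModel_append (s : List X) (x : X) (f : X → EReal) :
    markovLocalModel 𝒯 Q₀ (s ++ [x]) f = upperTrans 𝒯 f x := by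
  simp [markovLocalModel]

/-- A process on the nonempty situations which decreases in expectation under every transition
matrix extends to a supermartingale by the value `⊤` in the initial situation, which makes the
condition for the initial local model void. -/
lemma isSupermartingale_extend {P : List X → EReal} {c : ℝ} (hc : ∀ s, (c : EReal) ≤ P s)
    (hP : ∀ T ∈ 𝒯, ∀ s x, transApply T (fun y => P (s ++ [x] ++ [y])) x ≤ P (s ++ [x])) :
    IsSupermartingale (markovLocalModel 𝒯 Q₀) (fun s => if s = [] then ⊤ else P s) where
  bddBelow := ⟨c, fun s => by split_ifs; exacts [le_top, hc s]⟩
  le s := by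
    rcases s.eq_nil_or_concat' with rfl | ⟨s, x, rfl⟩
    · simp
    · rw [markovLocalModel_append]
      simp only [List.append_ne_nil_of_right_ne_nil _ (List.cons_ne_nil _ _), if_false]
      exact iSup₂_le fun T hT => hP T hT s x

lemma upperExp_singleton_le {f : (ℕ → X) → EReal} {P : List X → EReal} {c : ℝ}
    (hc : ∀ s, (c : EReal) ≤ P s)
    (hP : ∀ T ∈ 𝒯, ∀ s x, transApply T (fun y => P (s ++ [x] ++ [y])) x ≤ P (s ++ [x]))
    (hf : ∀ ω, f ω ≤ liminf (fun m => P (pathPrefix ω m)) atTop) (x : X) :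
    upperExp (markovLocalModel 𝒯 Q₀) f [x] ≤ P [x] := by
  refine sInf_le ⟨_, isSupermartingale_extend hc hP, fun ω _ => ?_, by simp⟩
  refine (hf ω).trans_eq (liminf_congr ?_)
  filter_upwards [eventually_gt_atTop 0] with m hm
  have : pathPrefix ω m ≠ [] := by
    rw [← List.length_pos_iff, length_pathPrefix]
    exact hm
  simp [this]

variable [DecidableEq X]

lemma upperExp_hittingTime_le (h_stoch : ∀ T ∈ 𝒯, T ∈ Matrix.rowStochastic ℝ X)
    (h_nonempty : 𝒯.Nonempty) (x : X) :
    upperExp (markovLocalModel 𝒯 Q₀) (hittingTime A) [x] ≤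
      ⨆ n, truncHit (upperTrans 𝒯) A n x := by
  have hΦ := isTransOperator_upperTrans h_stoch h_nonempty
  set h : X → EReal := fun y => ⨆ k, truncHit (upperTrans 𝒯) A k y
  set r : X → EReal := fun y => ⨆ k, truncTail (upperTrans 𝒯) A k y
  have h_nonneg : ∀ y, 0 ≤ h y := fun y => le_iSup_of_le 0 (truncHit_nonneg hΦ 0 y)
  have r_nonneg : ∀ y, 0 ≤ r y := fun y => le_iSup_of_le 0 (truncTail_nonneg hΦ 0 y)
  refine (upperExp_singleton_le (P := stoppedCost A ⊤ fun _ => r) (c := 0)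
    (fun s => stoppedCost_nonneg le_top (fun _ => r_nonneg) s) (fun T hT s y => ?_)
    (fun ω => ?_) x).trans ?_
  · refine transApply_stoppedCost_top_le (h_stoch T hT) h_nonneg
      (fun y hy => one_add_iSup_truncTail_le hy) s ?_
    refine transApply_iSup_le (fun _ _ => Matrix.nonneg_of_mem_rowStochastic (h_stoch T hT))
      (truncHit_monotone hΦ) (truncHit_nonneg hΦ) fun n => ?_
    exact (le_upperTrans hT _ y).trans
      (le_iSup (fun k => truncTail (upperTrans 𝒯) A k y) (n + 1))
  · rcases stoppedCost_top_pathPrefix_cases (A := A) (r := fun _ => r) (fun _ => r_nonneg) ω with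
      ⟨k, hk, h⟩ | ⟨-, h⟩
    · rw [hk, liminf_congr h, liminf_const]
    · have : Tendsto (fun m => stoppedCost A ⊤ (fun _ => r) (pathPrefix ω m)) atTop (𝓝 ⊤) :=
        tendsto_nhds_top_mono' (EReal.tendsto_coe_atTop.comp tendsto_natCast_atTop_atTop) h
      rw [this.liminf_eq]
      exact le_top
  · by_cases hx : x ∈ A
    · rw [stoppedCost_singleton_of_mem hx le_top]
      exact h_nonneg x
    · rw [stoppedCost_singleton_of_notMem hx le_top]
      exact one_add_iSup_truncTail_le hx

/-- If a supermartingale started below the truncated cost process, then along some path it would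
stay below it by a fixed margin, and so would not dominate the hitting time in the limit. -/
lemma truncHit_le_upperExp_hittingTime (h_stoch : ∀ T ∈ 𝒯, T ∈ Matrix.rowStochastic ℝ X)
    (h_nonempty : 𝒯.Nonempty) (n : ℕ) (x : X) :
    truncHit (upperTrans 𝒯) A n x ≤ upperExp (markovLocalModel 𝒯 Q₀) (hittingTime A) [x] := by
  have hΦ := isTransOperator_upperTrans h_stoch h_nonempty
  refine le_sInf ?_
  rintro _ ⟨M, hM, hlim, rfl⟩
  rw [← truncCost_singleton]
  by_contra! hlt
  set P := truncCost (upperTrans 𝒯) A n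
  obtain ⟨c, hc⟩ := hM.bddBelow
  obtain ⟨a, ha⟩ : ∃ a : ℝ, (a : EReal) = M [x] :=
    ⟨_, EReal.coe_toReal hlt.ne_top (ne_bot_of_le_ne_bot (EReal.coe_ne_bot c) (hc _))⟩
  rw [← ha] at hlt
  obtain ⟨b, hab, hb⟩ := EReal.lt_iff_exists_real_btwn.1 hlt
  have hε : 0 < b - a := sub_pos.2 (by exact_mod_cast hab)
  set ε := b - a
  obtain ⟨ω, hω0, hω⟩ := exists_path_of_extend (D := fun s => ε + M s < P s) (x := x)
    (by
      rw [← ha, ← EReal.coe_add, show ε + a = b by ring]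
      exact hb)
    (by
      intro s y hs
      by_contra! hle
      refine hs.not_ge ?_
      calc P (s ++ [y]) ≤ upperTrans 𝒯 (fun z => P (s ++ [y] ++ [z])) y :=
            truncCost_le_apply hΦ n s y
        _ ≤ upperTrans 𝒯 (fun z => ε + M (s ++ [y] ++ [z])) y := hΦ.mono hle y
        _ ≤ ε + upperTrans 𝒯 (fun z => M (s ++ [y] ++ [z])) y :=
            upperTrans_const_add_le h_stoch ε _ y
        _ ≤ ε + M (s ++ [y]) := by
            gcongr
            simpa only [markovLocalModel_append] using hM.le (s ++ [y]))
  obtain ⟨q, hq, hev⟩ := eventually_truncCost_pathPrefix_eq (Φ := upperTrans 𝒯) (A := A) n ω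
  have hle : liminf (fun m => M (pathPrefix ω m)) atTop ≤ ((q - ε : ℝ) : EReal) := by
    refine liminf_le_of_frequently_le' (Eventually.frequently ?_)
    filter_upwards [hev, eventually_gt_atTop 0] with m hm hm0
    obtain ⟨m, rfl⟩ : ∃ j, m = j + 1 := ⟨m - 1, by omega⟩
    have := (hω m).le
    rw [show P (pathPrefix ω (m + 1)) = q from hm, add_comm] at this
    exact EReal.le_sub_iff_add_le (.inl (EReal.coe_ne_bot _)) (.inl (EReal.coe_ne_top _)) |>.2 this
  have := (hq.trans (hlim ω (by simp [pathPrefix, hω0]))).trans hle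
  have : (q : ℝ) ≤ q - ε := by exact_mod_cast this
  linarith

lemma truncHit_le_lowerExp_hittingTime (h_stoch : ∀ T ∈ 𝒯, T ∈ Matrix.rowStochastic ℝ X)
    (h_nonempty : 𝒯.Nonempty) (n : ℕ) (x : X) :
    truncHit (lowerTrans 𝒯) A n x ≤ lowerExp (markovLocalModel 𝒯 Q₀) (hittingTime A) [x] := by
  have hΦ := isTransOperator_lowerTrans h_stoch h_nonempty
  rw [lowerExp, EReal.le_neg, ← truncCost_singleton]
  refine upperExp_singleton_le (P := fun s => -truncCost (lowerTrans 𝒯) A n s)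
    (c := -((n + 1) + (n + 1))) (fun s => ?_) (fun T hT s y => ?_) (fun ω => ?_) x
  · rw [EReal.coe_neg]
    exact EReal.neg_le_neg_iff.2 (truncCost_le hΦ n s)
  · rw [transApply_neg _
      (fun z => ne_bot_of_le_ne_bot EReal.zero_ne_bot (truncCost_nonneg hΦ n _))
      (fun z => ne_top_of_le_ne_top (EReal.coe_ne_top _) (truncCost_le hΦ n _))]
    exact EReal.neg_le_neg_iff.2 ((truncCost_le_apply hΦ n s y).trans (lowerTrans_le hT _ y))
  · obtain ⟨q, hq, hev⟩ := eventually_truncCost_pathPrefix_eq (Φ := lowerTrans 𝒯) (A := A) n ω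
    rw [liminf_congr (hev.mono fun m hm => congrArg Neg.neg hm), liminf_const]
    exact EReal.neg_le_neg_iff.2 hq

/-- A single matrix makes the sum of a supermartingale and the untruncated cost process decrease
in expectation. If this sum started below zero, it would stay below a negative number along some
path; such a path must hit `A`, as the cost is otherwise unbounded, and then the supermartingale
falls short of minus the hitting time. -/
lemma lowerExp_hittingTime_le [Nonempty X] (h_stoch : ∀ T ∈ 𝒯, T ∈ Matrix.rowStochastic ℝ X)
    (h_nonempty : 𝒯.Nonempty) (h_closed : IsClosed 𝒯) (h_rows : HasSeparatelySpecifiedRows 𝒯)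
    (x : X) :
    lowerExp (markovLocalModel 𝒯 Q₀) (hittingTime A) [x] ≤
      ⨆ n, truncHit (lowerTrans 𝒯) A n x := by
  have hΦ := isTransOperator_lowerTrans h_stoch h_nonempty
  obtain ⟨T, hT, hTr⟩ :=
    exists_transApply_iSup_truncHit_le (A := A) h_stoch h_nonempty h_closed h_rows
  set h : X → EReal := fun y => ⨆ k, truncHit (lowerTrans 𝒯) A k y
  set r : X → EReal := fun y => ⨆ k, truncTail (lowerTrans 𝒯) A k y
  have h_nonneg : ∀ y, 0 ≤ h y := fun y => le_iSup_of_le 0 (truncHit_nonneg hΦ 0 y)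
  have r_nonneg : ∀ y, 0 ≤ r y := fun y => le_iSup_of_le 0 (truncTail_nonneg hΦ 0 y)
  set P : List X → EReal := stoppedCost A ⊤ fun _ => r
  change _ ≤ h x
  rw [lowerExp, EReal.neg_le]
  refine le_sInf ?_
  rintro _ ⟨M, hM, hlim, rfl⟩
  obtain ⟨c, hc⟩ := hM.bddBelow
  have hPx : P [x] ≤ h x := by
    by_cases hx : x ∈ A
    · exact (stoppedCost_singleton_of_mem hx le_top).trans_le (h_nonneg x)
    · exact (stoppedCost_singleton_of_notMem hx le_top).trans_le (one_add_iSup_truncTail_le hx)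
  by_contra! hlt
  obtain ⟨b, hMb, hb⟩ : ∃ b : ℝ, M [x] + P [x] < b ∧ (b : EReal) < 0 := by
    refine EReal.lt_iff_exists_real_btwn.1 ((add_le_add_right hPx _).trans_lt ?_)
    have h1 : h x < -M [x] := EReal.lt_neg_comm.1 hlt
    rw [add_comm]
    exact EReal.add_lt_of_lt_sub (by rwa [zero_sub])
  obtain ⟨ω, hω0, hω⟩ := exists_path_of_extend (D := fun s => M s + P s ≤ b) hMb.le
    (by
      intro s y hs
      refine exists_le_of_transApply_le (h_stoch T hT) (x := y) ?_
      rw [transApply_add fun _ _ => Matrix.nonneg_of_mem_rowStochastic (h_stoch T hT)]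
      refine le_trans (add_le_add ?_ ?_) hs
      · have := hM.le (s ++ [y])
        rw [markovLocalModel_append] at this
        exact (le_upperTrans hT _ y).trans this
      · exact transApply_stoppedCost_top_le (h_stoch T hT) h_nonneg
          (fun z hz => one_add_iSup_truncTail_le hz) s (hTr y))
  rcases stoppedCost_top_pathPrefix_cases (A := A) (r := fun _ => r) (fun _ => r_nonneg) ω with
    ⟨k, hk, hev⟩ | ⟨-, hge⟩
  · have hle : liminf (fun m => M (pathPrefix ω m)) atTop ≤ ((b - k : ℝ) : EReal) := by
      refine liminf_le_of_frequently_le' (Eventually.frequently ?_)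
      filter_upwards [hev, eventually_gt_atTop 0] with m hm hm0
      obtain ⟨m, rfl⟩ : ∃ j, m = j + 1 := ⟨m - 1, by omega⟩
      have := hω m
      rw [show P (pathPrefix ω (m + 1)) = k from hm] at this
      exact EReal.le_sub_iff_add_le (.inl (EReal.coe_ne_bot _)) (.inl (EReal.coe_ne_top _))
        |>.2 this
    have := (hlim ω (by simp [pathPrefix, hω0])).trans hle
    change -hittingTime A ω ≤ _ at this
    rw [hk] at this
    have h1 : -(k : ℝ) ≤ b - k := EReal.coe_le_coe_iff.1 this
    have h2 : b < 0 := by exact_mod_cast hb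
    linarith
  · obtain ⟨m, hm⟩ := exists_nat_gt (b - c)
    have h1 := (add_le_add (hc _) (hge (m + 1))).trans (hω m)
    have h2 : c + ((m + 1 : ℕ) : ℝ) ≤ b := by exact_mod_cast h1
    push_cast at h2
    linarith

end Martingale
end ImpreciseMarkov

theorem mainTheorem5 {X : Type*} [Fintype X] [DecidableEq X] [Nonempty X]
    (𝒯 : Set (Matrix X X ℝ))
    (h_stoch : ∀ T ∈ 𝒯, T ∈ Matrix.rowStochastic ℝ X)
    (h_nonempty : 𝒯.Nonempty) (h_closed : IsClosed 𝒯) (h_convex : Convex ℝ 𝒯)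
    (h_rows : HasSeparatelySpecifiedRows 𝒯)
    (Q₀ : (X → EReal) → EReal) (hQ₀ : IsLocalModel Q₀)
    (A : Set X) :
    Tendsto (lowerIter 𝒯 A) atTop
        (𝓝 (fun x => lowerExp (markovLocalModel 𝒯 Q₀) (hittingTime A) [x])) ∧
      Tendsto (upperIter 𝒯 A) atTop
        (𝓝 (fun x => upperExp (markovLocalModel 𝒯 Q₀) (hittingTime A) [x])) := by
  have hlower : (fun x => lowerExp (markovLocalModel 𝒯 Q₀) (hittingTime A) [x]) =
      ⨆ n, truncHit (lowerTrans 𝒯) A n := by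
    funext x
    rw [iSup_apply]
    exact le_antisymm (lowerExp_hittingTime_le h_stoch h_nonempty h_closed h_rows x)
      (iSup_le fun n => truncHit_le_lowerExp_hittingTime h_stoch h_nonempty n x)
  have hupper : (fun x => upperExp (markovLocalModel 𝒯 Q₀) (hittingTime A) [x]) =
      ⨆ n, truncHit (upperTrans 𝒯) A n := by
    funext x
    rw [iSup_apply]
    exact le_antisymm (upperExp_hittingTime_le h_stoch h_nonempty x)
      (iSup_le fun n => truncHit_le_upperExp_hittingTime h_stoch h_nonempty n x)
  rw [hlower, hupper, funext lowerIter_eq_truncHit, funext upperIter_eq_truncHit]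
  exact ⟨tendsto_atTop_iSup
      (truncHit_monotone (isTransOperator_lowerTrans h_stoch h_nonempty)),
    tendsto_atTop_iSup (truncHit_monotone (isTransOperator_upperTrans h_stoch h_nonempty))⟩
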